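/- Let $n\ge 1$ and let $Y$ be a random vector of $\mathbb{R}^n$ with independent components, mean $f=\mathbb{E}(Y)$ and noise $\xi=Y-f$. Write $|\cdot|_2$ for the Euclidean norm and $\kappa=18$. Assume that for some $\sigma>0$ the noise is sub-Gaussian in the sense that $$\log \mathbb{E}\left[e^{\lambda \xi_i}\right]\le \frac{\lambda^2\sigma^2}{2}\qquad\text{for all }\lambda\in\mathbb{R},\ i=1,\dots,n .$$ Let $\{S_m,\ m\in\mathcal M\}$ be a family of linear subspaces of $\mathbb{R}^n$, let $D_m=\dim S_m$, let $\hat f_m=\Pi_{S_m}Y$ be the least-squares estimator (orthogonal projection of $Y$ onto $S_m$), and let $\{\Delta_m,\ m\in\mathcal M\}$ be nonnegative numbers such that $\Sigma=\sum_{m\in\mathcal M}e^{-\Delta_m}<+\infty$. Let $K>1$ and let $\mathrm{pen}:\mathcal M\to\mathbb{R}_+$ satisfy $$\mathrm{pen}(m)\ge K\kappa^2\sigma^2\,(D_m+\Delta_m)\qquad\text{for all } m\in\mathcal M .$$ If $\hat m$ is selected from the data as any minimizer over $\mathcal M$ of $\mathrm{crit}(m)=|Y-\hat f_m|_2^2+\mathrm{pen}(m)$,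 then all the expectations below are finite and $$\mathbb{E}\left[|f-\hat f_{\hat m}|_2^2\right]\le \frac{K(K^2+K-1)}{(K-1)^3}\,\inf_{m\in\mathcal M}\left(\mathbb{E}\left[|f-\hat f_m|_2^2\right]+\mathrm{pen}(m)\right)+\frac{K^3\kappa^2\sigma^2}{(K-1)^2}\,\Sigma .$$ -/

import Mathlib

open MeasureTheory ProbabilityTheory

noncomputable section

namespace ModelSelection

/-- The numerical constant `κ = 18`. -/
def kappa : ℝ := 18

/-- The real random variable `ξ` satisfies
`log E[exp (λ ξ)] ≤ λ² σ² / (2 (1 - |λ| c))` for all `λ ∈ (-1/c, 1/c)`, where `1/0 = +∞`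
(for `c ≥ 0` the range is written `|λ| c < 1`, which is every real `λ` when `c = 0`).
Finiteness of the exponential moment is part of the condition. -/
def BernsteinCondition {Ω : Type*} [MeasurableSpace Ω] (μ : Measure Ω) (ξ : Ω → ℝ)
    (σ c : ℝ) : Prop :=
  ∀ l : ℝ, |l| * c < 1 →
    Integrable (fun ω => Real.exp (l * ξ ω)) μ ∧
      Real.log (∫ ω, Real.exp (l * ξ ω) ∂μ) ≤ l ^ 2 * σ ^ 2 / (2 * (1 - |l| * c))

/-- The least-squares estimator `Π_S y`: the orthogonal projection of the observation `y`
onto the linear subspace `S` of Euclidean `ℝⁿ`. -/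
def lsEstimator {n : ℕ} (S : Submodule ℝ (EuclideanSpace ℝ (Fin n)))
    (y : EuclideanSpace ℝ (Fin n)) : EuclideanSpace ℝ (Fin n) :=
  S.starProjection y

/-- The penalized criterion `crit(m) = |y - Π_{S_m} y|² + pen(m)`. -/
def crit {n : ℕ} {M : Type*} (S : M → Submodule ℝ (EuclideanSpace ℝ (Fin n)))
    (pen : M → ℝ) (y : EuclideanSpace ℝ (Fin n)) (m : M) : ℝ :=
  ‖y - lsEstimator (S m) y‖ ^ 2 + pen m

end ModelSelection

end

/-!
The selected estimator is compared with a fixed model `m` by a deterministic inequality. Writing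
`ξ = Y - f`, `e = f - f̂_m̂` and `g = f - f̂_m`, minimality of the criterion at `m̂` gives
`‖e‖² + pen m̂ ≤ ‖g‖² + pen m + 2⟪ξ, g⟫ - 2⟪ξ, e⟫`. The error `e` lies in the space `T_m̂` spanned by
`S_m̂` and `f`, so `-2⟪ξ, e⟫ ≤ ‖e‖² / K + K ‖Π_{T_m̂} ξ‖²` (`sq_norm_le_of_penalized_le`). The term
`⟪ξ, g⟫` has mean `-E‖Π_{S_m} ξ‖² ≤ 0` (`integral_inner_sub_starProjection_nonpos`), so that only
`K ‖Π_{T_m̂} ξ‖² - pen m̂` has to be controlled. Handling `⟪ξ, g⟫` in the mean, rather than projecting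
`ξ` onto `S_m + S_m̂`, keeps the dimension of `S_m` out of the bound.

For a fixed model, `‖Π_T ξ‖²` has at most the exponential moment of a `χ²`
variable (`lintegral_exp_sq_norm_starProjection_le`): linear forms of `ξ` are sub-Gaussian by independence,
and `exp (‖x‖² / (4 σ²))` is a mixture of the exponentials `exp ⟪v, x⟫` with Gaussian weights in `v`.
Since `x - a ≤ b exp ((x - a) / b)`, the excess of `‖Π_{T_m} ξ‖²` over `κ² σ² (D_m + Δ_m)` is at most
a positive variable of mean at most `κ² σ² exp (-Δ_m)` (`lintegral_excess_le`), and bounding the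
variable of index `m̂` by the sum over all models gives `Σ` (`integral_le_tsum_of_forall_exists_le`).

The result is `(1 - 1/K) E‖e‖² ≤ E‖g‖² + pen m + K κ² σ² Σ`, whose constants `K / (K - 1)` and
`K² / (K - 1)` are smaller than those of the statement.
-/

open scoped ENNReal RealInnerProductSpace

/-! ### A Gaussian mixture bound for the norm of a sub-Gaussian vector -/

section GaussianMixture

variable {V : Type*} [NormedAddCommGroup V] [InnerProductSpace ℝ V] [FiniteDimensional ℝ V]
  [MeasurableSpace V] [BorelSpace V]

theorem lintegral_exp_neg_mul_sq_norm {b : ℝ} (hb : 0 < b) :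
    ∫⁻ v : V, ENNReal.ofReal (Real.exp (-b * ‖v‖ ^ 2)) =
      ENNReal.ofReal ((Real.pi / b) ^ (Module.finrank ℝ V / 2 : ℝ)) := by
  have hint : Integrable (fun v : V => Real.exp (-b * ‖v‖ ^ 2)) := by
    refine Integrable.of_integral_ne_zero ?_
    rw [GaussianFourier.integral_rexp_neg_mul_sq_norm hb]
    positivity
  rw [← GaussianFourier.integral_rexp_neg_mul_sq_norm hb,
    ofReal_integral_eq_lintegral_ofReal hint (ae_of_all _ fun v => (Real.exp_pos _).le)]

theorem lintegral_exp_neg_mul_sq_norm_add_inner {b : ℝ} (hb : 0 < b) (w : V) :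
    ∫⁻ v : V, ENNReal.ofReal (Real.exp (-b * ‖v‖ ^ 2 + ⟪v, w⟫)) =
      ENNReal.ofReal ((Real.pi / b) ^ (Module.finrank ℝ V / 2 : ℝ)) *
        ENNReal.ofReal (Real.exp (‖w‖ ^ 2 / (4 * b))) := by
  have hsq : ∀ v : V, ENNReal.ofReal (Real.exp (-b * ‖v‖ ^ 2 + ⟪v, w⟫)) =
      ENNReal.ofReal (Real.exp (-b * ‖v - (1 / (2 * b)) • w‖ ^ 2)) *
        ENNReal.ofReal (Real.exp (‖w‖ ^ 2 / (4 * b))) := by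
    intro v
    rw [← ENNReal.ofReal_mul (Real.exp_pos _).le, ← Real.exp_add, norm_sub_sq_real,
      inner_smul_right, norm_smul, Real.norm_of_nonneg (by positivity)]
    congr 2
    field_simp
    ring
  simp_rw [hsq]
  rw [lintegral_mul_const _ (by fun_prop),
    lintegral_sub_right_eq_self (fun v : V => ENNReal.ofReal (Real.exp (-b * ‖v‖ ^ 2))),
    lintegral_exp_neg_mul_sq_norm hb]

/-- If every linear form `⟪v, X⟫` is sub-Gaussian with variance factor `b ‖v‖²`, then `‖X‖²` has
at most the exponential moment that a Gaussian vector with covariance `b • 1` would have. The exponential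
of `‖X‖²` is a mixture of exponentials of the linear forms `⟪v, X⟫` against a Gaussian weight. -/
theorem lintegral_exp_sq_norm_le_of_subgaussian {Ω : Type*} [MeasurableSpace Ω] (μ : Measure Ω)
    [SFinite μ] {X : Ω → V} (hX : Measurable X) {b : ℝ} (hb : 0 < b)
    (hsub : ∀ v : V, ∫⁻ ω, ENNReal.ofReal (Real.exp ⟪v, X ω⟫) ∂μ ≤
      ENNReal.ofReal (Real.exp (b * ‖v‖ ^ 2 / 2))) :
    ∫⁻ ω, ENNReal.ofReal (Real.exp (‖X ω‖ ^ 2 / (4 * b))) ∂μ ≤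
      ENNReal.ofReal (2 ^ (Module.finrank ℝ V / 2 : ℝ)) := by
  set d : ℝ := Module.finrank ℝ V / 2
  have hc : 0 < (Real.pi / b) ^ d := by positivity
  have hmix : ENNReal.ofReal ((Real.pi / b) ^ d) *
        ∫⁻ ω, ENNReal.ofReal (Real.exp (‖X ω‖ ^ 2 / (4 * b))) ∂μ ≤
      ENNReal.ofReal ((Real.pi / b) ^ d) * ENNReal.ofReal (2 ^ d) :=
    calc
      _ = ∫⁻ ω, ∫⁻ v : V, ENNReal.ofReal (Real.exp (-b * ‖v‖ ^ 2 + ⟪v, X ω⟫)) ∂volume ∂μ := by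
        rw [← lintegral_const_mul _ (by fun_prop)]
        simp_rw [lintegral_exp_neg_mul_sq_norm_add_inner hb]
        rfl
      _ = ∫⁻ v : V, ∫⁻ ω, ENNReal.ofReal (Real.exp (-b * ‖v‖ ^ 2 + ⟪v, X ω⟫)) ∂μ :=
        lintegral_lintegral_swap (by unfold Function.uncurry; fun_prop)
      _ ≤ ∫⁻ v : V, ENNReal.ofReal (Real.exp (-(b / 2) * ‖v‖ ^ 2)) := by
        refine lintegral_mono fun v => ?_
        simp_rw [Real.exp_add, ENNReal.ofReal_mul (Real.exp_pos _).le]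
        rw [lintegral_const_mul _ (by fun_prop)]
        refine (mul_le_mul_right (hsub v) _).trans_eq ?_
        rw [← ENNReal.ofReal_mul (Real.exp_pos _).le, ← Real.exp_add]
        congr 2
        ring
      _ = _ := by
        rw [lintegral_exp_neg_mul_sq_norm (by positivity), ← ENNReal.ofReal_mul hc.le,
          ← Real.mul_rpow (by positivity) (by positivity)]
        congr 2
        field_simp
  exact (ENNReal.mul_le_mul_iff_right (by simpa using hc) ENNReal.ofReal_ne_top).1 hmix

end GaussianMixture

/-! ### Linear forms and projections of the noise vector -/

theorem ModelSelection.BernsteinCondition.hasSubgaussianMGF {Ω : Type*} [MeasurableSpace Ω]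
    {μ : Measure Ω} [NeZero μ] {X : Ω → ℝ} {σ : ℝ}
    (h : ModelSelection.BernsteinCondition μ X σ 0) :
    HasSubgaussianMGF X ⟨σ ^ 2, sq_nonneg σ⟩ μ where
  integrable_exp_mul t := (h t (by simp)).1
  mgf_le t := by
    obtain ⟨hi, hl⟩ := h t (by simp)
    refine ((Real.log_le_iff_le_exp (integral_exp_pos hi)).1 hl).trans_eq ?_
    simp only [mul_zero, sub_zero, mul_one]
    rw [mul_comm (t ^ 2)]
    rfl

section Noise

variable {Ω : Type*} [MeasurableSpace Ω] {μ : Measure Ω} {n : ℕ}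
  {ξ : Ω → EuclideanSpace ℝ (Fin n)} {σ : ℝ}

theorem lintegral_exp_inner_le_of_iIndepFun (hindep : iIndepFun (fun i ω => ξ ω i) μ)
    (hsub : ∀ i, HasSubgaussianMGF (fun ω => ξ ω i) ⟨σ ^ 2, sq_nonneg σ⟩ μ)
    (u : EuclideanSpace ℝ (Fin n)) :
    ∫⁻ ω, ENNReal.ofReal (Real.exp ⟪u, ξ ω⟫) ∂μ ≤
      ENNReal.ofReal (Real.exp (σ ^ 2 * ‖u‖ ^ 2 / 2)) := by
  have hI : iIndepFun (fun i ω => u i * ξ ω i) μ :=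
    hindep.comp (fun i x => u i * x) fun i => by fun_prop
  have hS := HasSubgaussianMGF.sum_of_iIndepFun hI (s := Finset.univ)
    fun i _ => (hsub i).const_mul (u i)
  have hinner : ∀ ω, ∑ i, u i * ξ ω i = ⟪u, ξ ω⟫ := fun ω => by
    simp [PiLp.inner_apply, mul_comm]
  simp only [hinner] at hS
  have hint := hS.integrable_exp_mul 1
  have hle := hS.mgf_le 1
  simp only [mgf, one_mul] at hint hle
  rw [← ofReal_integral_eq_lintegral_ofReal hint (ae_of_all _ fun _ => (Real.exp_pos _).le)]
  refine ENNReal.ofReal_le_ofReal (hle.trans_eq ?_)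
  rw [EuclideanSpace.real_norm_sq_eq, Finset.mul_sum]
  simp only [NNReal.coe_sum, one_pow, mul_one]
  exact congrArg (fun x => Real.exp (x / 2)) (Finset.sum_congr rfl fun i _ => mul_comm _ _)

/-- The squared length of the projection of the noise onto a subspace of dimension `d` has
at most the exponential moment of a `σ²`-scaled chi-square variable with `d` degrees of freedom. -/
theorem lintegral_exp_sq_norm_starProjection_le [SFinite μ] (hξ : Measurable ξ) (hσ : 0 < σ)
    (hindep : iIndepFun (fun i ω => ξ ω i) μ)
    (hsub : ∀ i, HasSubgaussianMGF (fun ω => ξ ω i) ⟨σ ^ 2, sq_nonneg σ⟩ μ)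
    (T : Submodule ℝ (EuclideanSpace ℝ (Fin n))) :
    ∫⁻ ω, ENNReal.ofReal (Real.exp (‖T.starProjection (ξ ω)‖ ^ 2 / (4 * σ ^ 2))) ∂μ ≤
      ENNReal.ofReal (2 ^ (Module.finrank ℝ T / 2 : ℝ)) := by
  refine lintegral_exp_sq_norm_le_of_subgaussian (V := T) μ
    (X := fun ω => T.orthogonalProjectionOnto (ξ ω)) (by fun_prop) (by positivity) fun v => ?_
  simpa using lintegral_exp_inner_le_of_iIndepFun hindep hsub (v : EuclideanSpace ℝ (Fin n))

theorem le_mul_exp_div_sub {x a b : ℝ} (hb : 0 < b) : x - a ≤ b * Real.exp (x / b - a / b) := by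
  have h : x - a = b * (x / b - a / b) := by field_simp
  rw [h]
  gcongr
  linarith [Real.add_one_le_exp (x / b - a / b)]

theorem integrable_sq_norm_noise [SFinite μ] (hξ : Measurable ξ) (hσ : 0 < σ)
    (hindep : iIndepFun (fun i ω => ξ ω i) μ)
    (hsub : ∀ i, HasSubgaussianMGF (fun ω => ξ ω i) ⟨σ ^ 2, sq_nonneg σ⟩ μ) :
    Integrable (fun ω => ‖ξ ω‖ ^ 2) μ := by
  have hlt : ∫⁻ ω, ENNReal.ofReal (Real.exp (‖ξ ω‖ ^ 2 / (4 * σ ^ 2))) ∂μ ≠ ∞ :=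
    ((lintegral_exp_sq_norm_le_of_subgaussian μ hξ (by positivity)
      (lintegral_exp_inner_le_of_iIndepFun hindep hsub)).trans_lt ENNReal.ofReal_lt_top).ne
  rw [lintegral_ofReal_ne_top_iff_integrable (by fun_prop)
    (ae_of_all _ fun _ => (Real.exp_pos _).le)] at hlt
  refine (hlt.const_mul (4 * σ ^ 2)).mono' (by fun_prop) (ae_of_all _ fun ω => ?_)
  rw [Real.norm_of_nonneg (by positivity)]
  simpa using le_mul_exp_div_sub (x := ‖ξ ω‖ ^ 2) (a := 0) (b := 4 * σ ^ 2) (by positivity)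

/-- The cross term between the noise and the error of a fixed least-squares estimator has
nonpositive mean: its only non-centred part is `-‖Π_S ξ‖²`. -/
theorem integral_inner_sub_starProjection_nonpos (hint : Integrable ξ μ)
    (hmean : ∫ ω, ξ ω ∂μ = 0) (hsq : Integrable (fun ω => ‖ξ ω‖ ^ 2) μ)
    (S : Submodule ℝ (EuclideanSpace ℝ (Fin n))) (f : EuclideanSpace ℝ (Fin n)) :
    Integrable (fun ω => ⟪ξ ω, f - S.starProjection (f + ξ ω)⟫) μ ∧
      ∫ ω, ⟪ξ ω, f - S.starProjection (f + ξ ω)⟫ ∂μ ≤ 0 := by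
  have hdecomp : ∀ ω, ⟪ξ ω, f - S.starProjection (f + ξ ω)⟫ =
      ⟪f - S.starProjection f, ξ ω⟫ - ‖S.starProjection (ξ ω)‖ ^ 2 := fun ω => by
    rw [map_add, ← sub_sub, inner_sub_right, real_inner_comm, ← real_inner_self_eq_norm_sq,
      Submodule.inner_starProjection_left_eq_right,
      Submodule.starProjection_eq_self_iff.2 (S.starProjection_apply_mem _)]
  have hlin := hint.const_inner (𝕜 := ℝ) (f - S.starProjection f)
  have hproj : Integrable (fun ω => ‖S.starProjection (ξ ω)‖ ^ 2) μ := by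
    refine hsq.mono' (by fun_prop) (ae_of_all _ fun ω => ?_)
    rw [Real.norm_of_nonneg (by positivity)]
    gcongr
    exact S.norm_starProjection_apply_le _
  simp_rw [hdecomp]
  refine ⟨hlin.sub hproj, ?_⟩
  rw [integral_sub hlin hproj, integral_inner hint, hmean, inner_zero_right, zero_sub]
  exact neg_nonpos.2 (integral_nonneg fun ω => by positivity)

end Noise

/-! ### The deterministic inequality behind penalized least squares -/

/-- If `f - e` fits `f + ξ` better than `f - g` does, up to the penalties `p` and `q`, the loss
`‖e‖²` is controlled by `‖g‖²` and the projection of `ξ` onto any subspace `T` containing `e`. -/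
theorem sq_norm_le_of_penalized_le {E : Type*} [NormedAddCommGroup E] [InnerProductSpace ℝ E]
    (T : Submodule ℝ E) [T.HasOrthogonalProjection] {ξ e g : E} (he : e ∈ T) {p q K : ℝ}
    (hK : 0 < K) (h : ‖ξ + e‖ ^ 2 + p ≤ ‖ξ + g‖ ^ 2 + q) :
    (1 - 1 / K) * ‖e‖ ^ 2 ≤
      ‖g‖ ^ 2 + q + 2 * ⟪ξ, g⟫ + (K * ‖T.starProjection ξ‖ ^ 2 - p) := by
  have h1 : ⟪ξ, e⟫ = ⟪T.starProjection ξ, e⟫ := by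
    rw [Submodule.inner_starProjection_left_eq_right, Submodule.starProjection_eq_self_iff.2 he]
  have h2 := abs_le.1 (abs_real_inner_le_norm (T.starProjection ξ) e)
  have h3 : 2 * (‖T.starProjection ξ‖ * ‖e‖) ≤ K * ‖T.starProjection ξ‖ ^ 2 + 1 / K * ‖e‖ ^ 2 := by
    have h4 : K * ‖T.starProjection ξ‖ ^ 2 + 1 / K * ‖e‖ ^ 2 -
        2 * (‖T.starProjection ξ‖ * ‖e‖) = (K * ‖T.starProjection ξ‖ - ‖e‖) ^ 2 / K := by
      field_simp
      ring
    have h5 : 0 ≤ (K * ‖T.starProjection ξ‖ - ‖e‖) ^ 2 / K := by positivity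
    linarith
  rw [norm_add_sq_real, norm_add_sq_real, h1] at h
  linarith [h2.1]

/-! ### Summing over the models -/

/-- A union bound in expectation for a random index `m` about which no measurability is known. -/
theorem integral_le_tsum_of_forall_exists_le {Ω M : Type*} [MeasurableSpace Ω] {μ : Measure Ω}
    [Countable M] {Z : Ω → ℝ} (hZ : Integrable Z μ) {H : M → Ω → ℝ} (hH : ∀ m, Measurable (H m))
    (hle : ∀ ω, ∃ m, Z ω ≤ H m ω) {a : M → ℝ} (ha : ∀ m, 0 ≤ a m) (hsum : Summable a)
    (hHa : ∀ m, ∫⁻ ω, ENNReal.ofReal (H m ω) ∂μ ≤ ENNReal.ofReal (a m)) :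
    ∫ ω, Z ω ∂μ ≤ ∑' m, a m := by
  have hlint : ∫⁻ ω, ENNReal.ofReal (Z ω) ∂μ ≤ ENNReal.ofReal (∑' m, a m) :=
    calc
      _ ≤ ∫⁻ ω, ∑' m, ENNReal.ofReal (H m ω) ∂μ := by
        refine lintegral_mono fun ω => ?_
        obtain ⟨m, hm⟩ := hle ω
        exact (ENNReal.ofReal_le_ofReal hm).trans
          (ENNReal.le_tsum (f := fun m => ENNReal.ofReal (H m ω)) m)
      _ = ∑' m, ∫⁻ ω, ENNReal.ofReal (H m ω) ∂μ :=
        lintegral_tsum fun m => (hH m).ennreal_ofReal.aemeasurable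
      _ ≤ ∑' m, ENNReal.ofReal (a m) := ENNReal.tsum_le_tsum hHa
      _ = _ := (ENNReal.ofReal_tsum_of_nonneg ha hsum).symm
  rw [integral_eq_lintegral_pos_part_sub_lintegral_neg_part hZ]
  have h := ENNReal.toReal_mono ENNReal.ofReal_ne_top hlint
  rw [ENNReal.toReal_ofReal (tsum_nonneg ha)] at h
  linarith [ENNReal.toReal_nonneg (a := ∫⁻ ω, ENNReal.ofReal (-Z ω) ∂μ)]

theorem finrank_sup_span_singleton_le {E : Type*} [AddCommGroup E] [Module ℝ E]
    [FiniteDimensional ℝ E] (S : Submodule ℝ E) (f : E) :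
    Module.finrank ℝ ↥(S ⊔ Submodule.span ℝ {f}) ≤ Module.finrank ℝ S + 1 := by
  refine (Submodule.finrank_add_le_finrank_add_finrank _ _).trans ?_
  gcongr
  simpa using finrank_span_le_card (R := ℝ) ({f} : Set E)

/-- The variable integrated here dominates the excess of `‖Π_T ξ‖²` over the penalty level
`κ² σ² (D + δ)`, by `le_mul_exp_div_sub`. The extra dimension allowed in `T` costs only a constant
factor, so that the bound carries the weight `exp (-δ)` even when `D = 0`. -/
theorem lintegral_excess_le {Ω : Type*} [MeasurableSpace Ω] {μ : Measure Ω} [SFinite μ] {n : ℕ}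
    {ξ : Ω → EuclideanSpace ℝ (Fin n)} {σ : ℝ} (hξ : Measurable ξ) (hσ : 0 < σ)
    (hindep : iIndepFun (fun i ω => ξ ω i) μ)
    (hsub : ∀ i, HasSubgaussianMGF (fun ω => ξ ω i) ⟨σ ^ 2, sq_nonneg σ⟩ μ)
    (T : Submodule ℝ (EuclideanSpace ℝ (Fin n))) {D : ℕ} (hT : Module.finrank ℝ T ≤ D + 1)
    {δ : ℝ} (hδ : 0 ≤ δ) :
    ∫⁻ ω, ENNReal.ofReal (4 * σ ^ 2 * Real.exp (‖T.starProjection (ξ ω)‖ ^ 2 / (4 * σ ^ 2) -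
        ModelSelection.kappa ^ 2 * σ ^ 2 * (D + δ) / (4 * σ ^ 2))) ∂μ ≤
      ENNReal.ofReal (ModelSelection.kappa ^ 2 * σ ^ 2 * Real.exp (-δ)) := by
  have hlevel : ModelSelection.kappa ^ 2 * σ ^ 2 * (D + δ) / (4 * σ ^ 2) = 81 * (D + δ) := by
    unfold ModelSelection.kappa
    field_simp
    ring
  have hsplit : ∀ x : ℝ, ENNReal.ofReal (4 * σ ^ 2 * Real.exp (x - 81 * (D + δ))) =
      ENNReal.ofReal (4 * σ ^ 2 * Real.exp (-(81 * (D + δ)))) * ENNReal.ofReal (Real.exp x) := by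
    intro x
    rw [← ENNReal.ofReal_mul (by positivity), mul_assoc (4 * σ ^ 2), ← Real.exp_add,
      neg_add_eq_sub]
  simp_rw [hlevel, hsplit]
  rw [lintegral_const_mul _ (by fun_prop)]
  refine (mul_le_mul_right
    (lintegral_exp_sq_norm_starProjection_le hξ hσ hindep hsub T) _).trans ?_
  rw [← ENNReal.ofReal_mul (by positivity)]
  refine ENNReal.ofReal_le_ofReal ?_
  have hdim : (Module.finrank ℝ T : ℝ) ≤ D + 1 := by exact_mod_cast hT
  have htwo : (2 : ℝ) ^ (Module.finrank ℝ T / 2 : ℝ) ≤ Real.exp (Module.finrank ℝ T / 2) := by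
    rw [← Real.exp_one_rpow]
    exact Real.rpow_le_rpow (by norm_num) (by linarith [Real.add_one_le_exp (1 : ℝ)])
      (by positivity)
  have hD : (0 : ℝ) ≤ D := D.cast_nonneg
  calc
    _ ≤ 4 * σ ^ 2 * Real.exp (-(81 * (D + δ))) * Real.exp (Module.finrank ℝ T / 2) := by gcongr
    _ = 4 * σ ^ 2 * Real.exp (-(81 * (D + δ)) + Module.finrank ℝ T / 2) := by
      rw [Real.exp_add, mul_assoc]
    _ ≤ 4 * σ ^ 2 * Real.exp (1 + -δ) := by
      gcongr 4 * σ ^ 2 * Real.exp ?_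
      linarith
    _ = 4 * Real.exp 1 * σ ^ 2 * Real.exp (-δ) := by
      rw [Real.exp_add]
      ring
    _ ≤ ModelSelection.kappa ^ 2 * σ ^ 2 * Real.exp (-δ) := by
      gcongr
      unfold ModelSelection.kappa
      linarith [Real.exp_one_lt_d9]

/-! ### The oracle inequality -/

theorem mainTheorem5
    {Ω : Type*} [MeasurableSpace Ω] (μ : Measure Ω) [IsProbabilityMeasure μ]
    {n : ℕ}
    -- the observation: a random vector with independent components and mean `f`
    (Y : Ω → EuclideanSpace ℝ (Fin n)) (hY : Measurable Y)
    (hindep : iIndepFun (fun (i : Fin n) (ω : Ω) => Y ω i) μ)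
    (f : EuclideanSpace ℝ (Fin n)) (hf : f = ∫ ω, Y ω ∂μ)
    -- the components of the noise `Y - f` satisfy the exponential moment condition with `c = 0`
    (σ : ℝ) (hσ : 0 < σ)
    (hnoise : ∀ i : Fin n, ModelSelection.BernsteinCondition μ (fun ω => Y ω i - f i) σ 0)
    -- the models, the weights and the penalty
    {M : Type*} (S : M → Submodule ℝ (EuclideanSpace ℝ (Fin n)))
    (Δ : M → ℝ) (hΔ : ∀ m, 0 ≤ Δ m) (hsum : Summable fun m => Real.exp (-Δ m))
    (K : ℝ) (hK : 1 < K)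
    (pen : M → ℝ)
    (hpen : ∀ m, K * ModelSelection.kappa ^ 2 * σ ^ 2 *
      ((Module.finrank ℝ (S m) : ℝ) + Δ m) ≤ pen m)
    -- any selection rule minimizing the criterion whose estimator is a random vector
    (mhat : Ω → M)
    (hmin : ∀ ω m, ModelSelection.crit S pen (Y ω) (mhat ω) ≤ ModelSelection.crit S pen (Y ω) m)
    (hmeas : AEMeasurable (fun ω => ModelSelection.lsEstimator (S (mhat ω)) (Y ω)) μ) :
    Integrable (fun ω => ‖f - ModelSelection.lsEstimator (S (mhat ω)) (Y ω)‖ ^ 2) μ ∧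
    (∀ m, Integrable (fun ω => ‖f - ModelSelection.lsEstimator (S m) (Y ω)‖ ^ 2) μ) ∧
    ∫ ω, ‖f - ModelSelection.lsEstimator (S (mhat ω)) (Y ω)‖ ^ 2 ∂μ ≤
      K * (K ^ 2 + K - 1) / (K - 1) ^ 3 *
          (⨅ m, ((∫ ω, ‖f - ModelSelection.lsEstimator (S m) (Y ω)‖ ^ 2 ∂μ) + pen m)) +
        K ^ 3 * ModelSelection.kappa ^ 2 * σ ^ 2 / (K - 1) ^ 2 * ∑' m, Real.exp (-Δ m) := by
  have hne : Nonempty Ω := nonempty_of_isProbabilityMeasure μ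
  have : Nonempty M := ⟨mhat hne.some⟩
  have : Countable M := by
    have h := hsum.countable_support
    rw [Function.support_eq_univ fun m => (Real.exp_pos _).ne'] at h
    exact Set.countable_univ_iff.1 h
  set Sig : ℝ := ∑' m, Real.exp (-Δ m)
  have hK0 : 0 < K := by linarith
  have hK1 : 0 < K - 1 := by linarith
  -- the noise vector
  set ξ : Ω → EuclideanSpace ℝ (Fin n) := fun ω => Y ω - f with hξdef
  have hξ : Measurable ξ := hY.sub_const f
  have hYξ : ∀ ω, Y ω = f + ξ ω := fun ω => by simp [hξdef]
  have hsub : ∀ i, HasSubgaussianMGF (fun ω => ξ ω i) ⟨σ ^ 2, sq_nonneg σ⟩ μ := fun i =>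
    (hnoise i).hasSubgaussianMGF
  have hind : iIndepFun (fun i ω => ξ ω i) μ :=
    hindep.comp (fun i x => x - f i) fun i => by fun_prop
  have hsq : Integrable (fun ω => ‖ξ ω‖ ^ 2) μ := integrable_sq_norm_noise hξ hσ hind hsub
  have hint : Integrable ξ μ :=
    ((memLp_two_iff_integrable_sq_norm hξ.aestronglyMeasurable).2 hsq).integrable (by norm_num)
  have hmean : ∫ ω, ξ ω ∂μ = 0 := by
    have hYint : Integrable Y μ := by
      exact ((integrable_const f).add hint).congr (ae_of_all _ fun ω => (hYξ ω).symm)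
    simp only [hξdef]
    rw [integral_sub hYint (integrable_const f), ← hf]
    simp
  -- every least-squares error is at most `‖f‖ + ‖ξ‖`
  have hbound : ∀ ω m, ‖f - ModelSelection.lsEstimator (S m) (Y ω)‖ ^ 2 ≤
      2 * ‖f‖ ^ 2 + 2 * ‖ξ ω‖ ^ 2 := by
    intro ω m
    have hle : ‖f - ModelSelection.lsEstimator (S m) (Y ω)‖ ≤ ‖f‖ + ‖ξ ω‖ := by
      have h1 : f - ModelSelection.lsEstimator (S m) (Y ω) =
          (S m)ᗮ.starProjection f - (S m).starProjection (ξ ω) := by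
        rw [Submodule.starProjection_orthogonal_val, ModelSelection.lsEstimator, hYξ, map_add]
        abel
      rw [h1]
      exact (norm_sub_le _ _).trans (add_le_add ((S m)ᗮ.norm_starProjection_apply_le _)
        ((S m).norm_starProjection_apply_le _))
    calc
      _ ≤ (‖f‖ + ‖ξ ω‖) ^ 2 := by gcongr
      _ ≤ _ := by linarith [sq_nonneg (‖f‖ - ‖ξ ω‖)]
  have hdom : Integrable (fun ω => 2 * ‖f‖ ^ 2 + 2 * ‖ξ ω‖ ^ 2) μ :=
    (integrable_const _).add (hsq.const_mul 2)
  have hsel : Integrable (fun ω => ‖f - ModelSelection.lsEstimator (S (mhat ω)) (Y ω)‖ ^ 2) μ := by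
    refine hdom.mono' ((hmeas.const_sub f).norm.pow_const 2).aestronglyMeasurable
      (ae_of_all _ fun ω => ?_)
    rw [Real.norm_of_nonneg (by positivity)]
    exact hbound ω _
  have hfix : ∀ m, Integrable (fun ω => ‖f - ModelSelection.lsEstimator (S m) (Y ω)‖ ^ 2) μ := by
    intro m
    refine hdom.mono' ?_ (ae_of_all _ fun ω => ?_)
    · unfold ModelSelection.lsEstimator
      exact Measurable.aestronglyMeasurable (by fun_prop)
    · rw [Real.norm_of_nonneg (by positivity)]
      exact hbound ω m
  refine ⟨hsel, hfix, ?_⟩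
  set R : ℝ := ∫ ω, ‖f - ModelSelection.lsEstimator (S (mhat ω)) (Y ω)‖ ^ 2 ∂μ
  -- the sharper oracle inequality against a fixed model
  have horacle : ∀ m, (1 - 1 / K) * R ≤
      (∫ ω, ‖f - ModelSelection.lsEstimator (S m) (Y ω)‖ ^ 2 ∂μ) + pen m +
        K * ModelSelection.kappa ^ 2 * σ ^ 2 * Sig := by
    intro m
    obtain ⟨hcross, hcross0⟩ :=
      integral_inner_sub_starProjection_nonpos hint hmean hsq (S m) f
    simp_rw [← hYξ] at hcross hcross0
    -- adjoining `f` to the selected model puts its estimation error into the projection space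
    let T : M → Submodule ℝ (EuclideanSpace ℝ (Fin n)) := fun m' => S m' ⊔ Submodule.span ℝ {f}
    let H : M → Ω → ℝ := fun m' ω =>
      K * (4 * σ ^ 2 * Real.exp (‖(T m').starProjection (ξ ω)‖ ^ 2 / (4 * σ ^ 2) -
        ModelSelection.kappa ^ 2 * σ ^ 2 * (Module.finrank ℝ (S m') + Δ m') / (4 * σ ^ 2)))
    have hZ1 := hsel.const_mul (1 - 1 / K)
    have hZ2 := (hfix m).add (integrable_const (pen m))
    have hZ3 := hcross.const_mul 2
    have key := integral_le_tsum_of_forall_exists_le (hZ1.sub (hZ2.add hZ3)) (H := H)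
      (a := fun m' => K * (ModelSelection.kappa ^ 2 * σ ^ 2 * Real.exp (-Δ m')))
      (fun m' => by fun_prop) (fun ω => ⟨mhat ω, ?_⟩) (fun m' => by positivity)
      ((hsum.mul_left _).mul_left _) (fun m' => ?_)
    · rw [integral_sub' hZ1 (hZ2.add hZ3), integral_add' hZ2 hZ3,
        integral_add' (hfix m) (integrable_const _), integral_const_mul, integral_const_mul,
        tsum_mul_left, tsum_mul_left] at key
      simp only [integral_const, probReal_univ, one_smul] at key
      change (1 - 1 / K) * R - _ ≤ K * (ModelSelection.kappa ^ 2 * σ ^ 2 * Sig) at key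
      unfold ModelSelection.lsEstimator at key ⊢
      linarith
    · have he : f - ModelSelection.lsEstimator (S (mhat ω)) (Y ω) ∈ T (mhat ω) :=
        sub_mem (Submodule.mem_sup_right (Submodule.mem_span_singleton_self f))
          (Submodule.mem_sup_left (Submodule.starProjection_apply_mem _ _))
      have hcrit := hmin ω m
      have hres : ∀ v, Y ω - v = ξ ω + (f - v) := fun v => by simp [hξdef]
      simp only [ModelSelection.crit, hres] at hcrit
      have hdet := sq_norm_le_of_penalized_le (T (mhat ω)) he hK0 hcrit
      have hpen' := hpen (mhat ω)
      have hexc := mul_le_mul_of_nonneg_left (le_mul_exp_div_sub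
        (x := ‖(T (mhat ω)).starProjection (ξ ω)‖ ^ 2)
        (a := ModelSelection.kappa ^ 2 * σ ^ 2 *
          (Module.finrank ℝ (S (mhat ω)) + Δ (mhat ω)))
        (b := 4 * σ ^ 2) (by positivity)) hK0.le
      simp only [Pi.sub_apply, Pi.add_apply, H]
      unfold ModelSelection.lsEstimator at hdet ⊢
      linarith
    · simp only [H, ENNReal.ofReal_mul hK0.le]
      rw [lintegral_const_mul _ (by fun_prop)]
      exact mul_le_mul_right (lintegral_excess_le hξ hσ hind hsub (T m')
        (finrank_sup_span_singleton_le (S m') f) (hΔ m')) _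
  -- passing to the infimum and to the larger constants of the statement
  have hpen0 : ∀ m, 0 ≤ pen m := fun m => le_trans
    (mul_nonneg (by positivity) (add_nonneg (Nat.cast_nonneg _) (hΔ m))) (hpen m)
  set I : ℝ := ⨅ m, ((∫ ω, ‖f - ModelSelection.lsEstimator (S m) (Y ω)‖ ^ 2 ∂μ) + pen m)
  have hI0 : 0 ≤ I := Real.iInf_nonneg fun m =>
    add_nonneg (integral_nonneg fun ω => by positivity) (hpen0 m)
  have hSig0 : 0 ≤ Sig := tsum_nonneg fun m => (Real.exp_pos _).le
  have hI : (1 - 1 / K) * R - K * ModelSelection.kappa ^ 2 * σ ^ 2 * Sig ≤ I :=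
    le_ciInf fun m => by linarith [horacle m]
  have hR : R = K / (K - 1) * ((1 - 1 / K) * R) := by
    field_simp
  have hc1 : K / (K - 1) ≤ K * (K ^ 2 + K - 1) / (K - 1) ^ 3 := by
    rw [div_le_div_iff₀ hK1 (by positivity)]
    have h : 0 ≤ K * (K - 1) * (3 * K - 2) := by
      have : 0 ≤ 3 * K - 2 := by linarith
      positivity
    linarith
  have hc2 : K ^ 2 / (K - 1) ≤ K ^ 3 / (K - 1) ^ 2 := by
    rw [div_le_div_iff₀ hK1 (by positivity)]
    have h : 0 ≤ K ^ 2 * (K - 1) := by positivity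
    linarith
  calc
    R = K / (K - 1) * ((1 - 1 / K) * R) := hR
    _ ≤ K / (K - 1) * (I + K * ModelSelection.kappa ^ 2 * σ ^ 2 * Sig) := by
      gcongr
      linarith
    _ = K / (K - 1) * I + K ^ 2 / (K - 1) * (ModelSelection.kappa ^ 2 * σ ^ 2 * Sig) := by ring
    _ ≤ K * (K ^ 2 + K - 1) / (K - 1) ^ 3 * I +
        K ^ 3 / (K - 1) ^ 2 * (ModelSelection.kappa ^ 2 * σ ^ 2 * Sig) := by gcongr
    _ = _ := by ring
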